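/- Conventions. Let $L/K$ be a finite separable field extension with normal closure $\widetilde L$. A Hopf–Galois structure on $L/K$ is a finite-dimensional cocommutative $K$-Hopf algebra $\mathcal H$ together with an action making $L$ an $\mathcal H$-module algebra such that the map $L\otimes_K\mathcal H\to\mathrm{End}_K(L)$, $x\otimes h\mapsto (y\mapsto x\,(h\cdot y))$, is bijective. It is of type $N$, for a group $N$, if $\widetilde L\otimes_K\mathcal H\cong\widetilde L[N]$ as $\widetilde L$-Hopf algebras, and of cyclic type if it is of type $N$ for some cyclic group $N$. An extension $L'/K$ is parallel to $L/K$ if $K\subseteq L'\subseteq\widetilde L$ and $[L':K]=[L:K]$; it is conjugate to $L/K$ if $L'=\sigma(L)$ for some $\sigma\in\mathrm{Gal}(\widetilde L/K)$. For a group $N$, the holomorph $\mathrm{Hol}(N)=N\rtimes\mathrm{Aut}(N)$ acts on $N$ by $[\eta,\alpha]\cdot x=\eta\,\alpha(x)$; transitivity and stabilisers of subgroups of $\mathrm{Hol}(N)$ refer to this action. For $H\le G$, $\mathrm{Core}_G(H)$ is the largest normal subgroup of $G$ contained in $H$. **Theorem 1.1.** Let $L/K$ be a finite separable extension of odd prime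 power degree admitting a Hopf–Galois structure of cyclic type. For every extension $L'/K$ parallel to $L/K$, the following are equivalent: (1) $L'/K$ admits a Hopf–Galois structure of cyclic type; (2) $L'/K$ is conjugate to $L/K$. **Group-theoretic form.** Let $p$ be an odd prime, $e\ge 1$, and $N$ a cyclic group of order $p^e$. Let $G$ be a transitive subgroup of $\mathrm{Hol}(N)$, let $H$ be a subgroup of $G$ of index $p^e$, and let $C=\mathrm{Core}_G(H)$. The following are equivalent: (1) there are a transitive subgroup $T$ of $\mathrm{Hol}(N)$ and an isomorphism $G/C\to T$ taking $H/C$ onto $\mathrm{Stab}_T(1_N)$; (2) $H$ is conjugate to $\mathrm{Stab}_G(1_N)$ in $G$. -/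

import Mathlib

open scoped TensorProduct

universe u v w

/-! ### Hopf-Galois structures -/

/-- A Hopf-Galois structure on the field extension `L/K` with underlying `K`-Hopf algebra `H`
(finite-dimensional and cocommutative): a `K`-algebra action `act` of `H` on `L` which makes `L`
an `H`-module algebra and for which the Galois map `L ⊗ H → End_K(L)`,
`x ⊗ h ↦ (y ↦ x * (h · y))`, is bijective. -/
structure HopfGaloisStructure (K : Type u) (L : Type v) (H : Type w) [Field K] [Field L]
    [Algebra K L] [Ring H] [HopfAlgebra K H] where
  finite : Module.Finite K H
  cocomm : Coalgebra.IsCocomm K H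
  /-- the action of `H` on `L` -/
  act : H →ₐ[K] Module.End K L
  /-- `h · 1 = ε(h) 1` -/
  act_one : ∀ h : H, act h 1 = algebraMap K L (Coalgebra.counit (R := K) h)
  /-- `h · (x * y) = ∑ (h₁ · x) * (h₂ · y)`, where `Δ(h) = ∑ h₁ ⊗ h₂` -/
  act_mul : ∀ (h : H) (x y : L), act h (x * y) =
    LinearMap.mul' K L (TensorProduct.map (act.toLinearMap.flip x) (act.toLinearMap.flip y)
      (Coalgebra.comul (R := K) h))
  galois : Function.Bijective
    (LinearMap.mul' K (Module.End K L) ∘ₗ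
      TensorProduct.map (Algebra.lmul K L).toLinearMap act.toLinearMap :
        L ⊗[K] H →ₗ[K] Module.End K L)

/-- A normal closure of `L/K`, formed inside an algebraic closure of `L`. -/
abbrev NormalClosure (K : Type u) (L : Type v) [Field K] [Field L] [Algebra K L] : Type v :=
  IntermediateField.normalClosure K L (AlgebraicClosure L)

/-- The `K`-Hopf algebra `H` is of type `N` with respect to `L/K`: it becomes isomorphic to the
group algebra of `N` as a Hopf algebra after base change to the normal closure of `L/K`.
(A bialgebra isomorphism of Hopf algebras automatically respects the antipodes.) -/
def IsOfType (K : Type u) (L : Type v) (H : Type w) [Field K] [Field L] [Algebra K L]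
    [Ring H] [HopfAlgebra K H] (N : Type*) [Group N] : Prop :=
  Nonempty ((NormalClosure K L ⊗[K] H) ≃ₐc[NormalClosure K L]
    MonoidAlgebra (NormalClosure K L) N)

/-- `L/K` admits a Hopf-Galois structure of type `N`. The Hopf algebra is finite-dimensional
over `K`, so nothing is lost by taking it in the universe of `K`. -/
def AdmitsHopfGaloisOfType (K : Type u) (L : Type v) [Field K] [Field L] [Algebra K L]
    (N : Type*) [Group N] : Prop :=
  ∃ (H : Type u) (_ : Ring H) (_ : HopfAlgebra K H),
    Nonempty (HopfGaloisStructure K L H) ∧ IsOfType K L H N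

/-- `L/K` admits a Hopf-Galois structure of cyclic type. -/
def AdmitsHopfGaloisOfCyclicType (K : Type u) (L : Type v) [Field K] [Field L]
    [Algebra K L] : Prop :=
  ∃ (N : Type) (_ : Group N), IsCyclic N ∧ AdmitsHopfGaloisOfType K L N

/-! ### Parallel and conjugate extensions -/

/-- When `E` is a normal closure of `L/K`, the intermediate field `L'` of `E/K` is parallel to
`L/K` if it has the same degree over `K`. -/
def IsParallel {K : Type u} {E : Type v} [Field K] [Field E] [Algebra K E]
    (L L' : IntermediateField K E) : Prop :=
  Module.finrank K L' = Module.finrank K L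

/-- `L'` is conjugate to `L` over `K`, by an automorphism of `E/K`. -/
def IsConjugateField {K : Type u} {E : Type v} [Field K] [Field E] [Algebra K E]
    (L L' : IntermediateField K E) : Prop :=
  ∃ σ : E ≃ₐ[K] E, L.map (σ : E →ₐ[K] E) = L'

/-! ### The holomorph -/

/-- The holomorph `N ⋊ Aut(N)` of a group `N`. -/
abbrev Hol (N : Type*) [Group N] : Type _ := N ⋊[MonoidHom.id (MulAut N)] MulAut N

/-- The holomorph acts on `N` by `[n, α] • x = n * α(x)`. -/
instance Hol.instMulAction (N : Type*) [Group N] : MulAction (Hol N) N where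
  smul g x := g.left * g.right x
  one_smul x := by
    change (1 : Hol N).left * (1 : Hol N).right x = x
    simp
  mul_smul g h x := by
    change (g * h).left * (g * h).right x = g.left * g.right (h.left * h.right x)
    simp [mul_assoc]

/-- `G` is isomorphic to a transitive subgroup `T` of `Hol(N)` under an isomorphism that takes
the subgroup `H` of `G` to the stabiliser of `1` in `T`. -/
def IsTransitiveInHol (N : Type*) [Group N] (G : Type*) [Group G] (H : Subgroup G) : Prop :=
  ∃ T : Subgroup (Hol N), MulAction.IsPretransitive T N ∧
    ∃ f : G ≃* T, H.map f.toMonoidHom = MulAction.stabilizer T (1 : N)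

/-! ### Geometric sums modulo prime powers -/

/-! A subgroup of `Hol N`, for `N` cyclic of order `p ^ e`, acts by affine maps `z ↦ b + u * z` of
`ZMod (p ^ e)`. For `p` odd, lifting the exponent says that if `u` is 1 mod `p`, then `1 + u + ⋯ + u
^ (k - 1)` has the same `p`-part as `k`.

Two facts follow. A transitive affine group contains a `p ^ e`-cycle
(`IsAffineAction.exists_cycle`). Conversely, if `H` has index `p ^ e` in a faithful transitive
affine group and some element cycles all its cosets, then `H` is a point stabiliser
(`IsAffineAction.exists_eq_stabilizer`): a power of that element is a translation of order `p`
outside `H`, so `H` contains no translation but 1 and embeds in the cyclic group of units, and its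
generator has a fixed point. All point stabilisers are conjugate, and condition (1) supplies the
cycle.

For fields, the group-like elements of `E ⊗ H` form a copy of `N` acting simply transitively on the
embeddings `L → E`, and Galois automorphisms normalise this action, hence act affinely. Only this
half of the Greither–Pareigis correspondence is needed, since the converse implication is transport
of structure. -/

theorem Int.prime_pow_dvd_geom_sum_iff {p : ℕ} (hp : p.Prime) (hp2 : p ≠ 2) {x : ℤ} (hx : 1 < x)
    (hpx : (p : ℤ) ∣ x - 1) (k j : ℕ) :
    (p : ℤ) ^ j ∣ ∑ i ∈ Finset.range k, x ^ i ↔ p ^ j ∣ k := by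
  have hx' : ¬ (p : ℤ) ∣ x := fun h => by
    have h1 : (p : ℤ) ∣ 1 := by simpa using dvd_sub h hpx
    exact hp.one_lt.ne' (by exact_mod_cast Int.eq_one_of_dvd_one (by positivity) h1)
  -- Lifting the exponent on `x ^ k - 1`, which is the sum times `x - 1`; the multiplicity of `x -
  -- 1` is finite and cancels.
  have h1 := Int.emultiplicity_pow_sub_pow hp (hp.odd_of_ne_two hp2) hpx hx' k
  rw [one_pow, ← geom_sum_mul, emultiplicity_mul (Nat.prime_iff_prime_int.mp hp), add_comm] at h1
  have hfin : emultiplicity (p : ℤ) (x - 1) ≠ ⊤ := by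
    rw [← finiteMultiplicity_iff_emultiplicity_ne_top, Int.finiteMultiplicity_iff]
    refine ⟨?_, by omega⟩
    simpa using hp.one_lt.ne'
  have h2 := (ENat.add_right_injective_of_ne_top hfin) h1
  rw [pow_dvd_iff_le_emultiplicity, h2, ← pow_dvd_iff_le_emultiplicity]

namespace ZMod

variable {p e : ℕ}

theorem exists_int_lift_of_dvd_sub_one (hp : p.Prime) {u : ZMod (p ^ e)}
    (hu : (p : ZMod (p ^ e)) ∣ u - 1) :
    ∃ x : ℤ, 1 < x ∧ (p : ℤ) ∣ x - 1 ∧ (x : ZMod (p ^ e)) = u := by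
  obtain ⟨v, hv⟩ := hu
  have : NeZero (p ^ e) := ⟨(pow_pos hp.pos e).ne'⟩
  -- The extra `p ^ e` leaves the residue unchanged and keeps `x - 1` nonzero, so that its
  -- multiplicity is finite.
  refine ⟨1 + p * (v.val + p ^ e), ?_, ⟨v.val + p ^ e, by ring⟩, ?_⟩
  · have : 0 < (p : ℤ) := by exact_mod_cast hp.pos
    have : 0 < (p : ℤ) * (v.val + p ^ e) := by positivity
    omega
  · have h0 : (p : ZMod (p ^ e)) ^ e = 0 := by
      exact_mod_cast ZMod.natCast_self (p ^ e)
    push_cast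
    rw [h0, natCast_zmod_val, add_zero, ← hv]
    ring

theorem isUnit_or_natCast_prime_dvd (hp : p.Prime) (a : ZMod (p ^ e)) :
    IsUnit a ∨ (p : ZMod (p ^ e)) ∣ a := by
  have : NeZero (p ^ e) := ⟨(pow_pos hp.pos e).ne'⟩
  rw [← natCast_zmod_val a]
  by_cases h : p ∣ a.val
  · exact Or.inr (Nat.cast_dvd_cast h)
  · left
    rw [ZMod.isUnit_iff_coprime]
    exact Nat.Coprime.pow_right e ((hp.coprime_iff_not_dvd.mpr h).symm)

theorem natCast_prime_dvd_pow_sub_one (hp : p.Prime) (he : 1 ≤ e) {u : ZMod (p ^ e)}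
    (hu : IsUnit u) : (p : ZMod (p ^ e)) ∣ u ^ (p - 1) - 1 := by
  have : NeZero (p ^ e) := ⟨(pow_pos hp.pos e).ne'⟩
  have := Fact.mk hp
  rw [← natCast_zmod_val u, ZMod.isUnit_iff_coprime] at hu
  have hc : u.val.Coprime p := Nat.Coprime.coprime_dvd_right (dvd_pow_self p (by omega)) hu
  have h1 : ((p : ℕ) : ℤ) ∣ (u.val : ℤ) ^ (p - 1) - 1 := by
    rw [← ZMod.intCast_zmod_eq_zero_iff_dvd]
    push_cast
    rw [ZMod.pow_card_sub_one_eq_one, sub_self]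
    intro h0
    rw [ZMod.natCast_eq_zero_iff] at h0
    exact hp.one_lt.ne' (Nat.eq_one_of_dvd_coprimes hc h0 dvd_rfl)
  obtain ⟨c, hc⟩ := h1
  refine ⟨c, ?_⟩
  have := congrArg (Int.cast : ℤ → ZMod (p ^ e)) hc
  push_cast at this
  rwa [natCast_zmod_val] at this

theorem geom_sum_eq_zero_iff (hp : p.Prime) (hp2 : p ≠ 2) {u : ZMod (p ^ e)}
    (hu : (p : ZMod (p ^ e)) ∣ u - 1) (k : ℕ) :
    ∑ i ∈ Finset.range k, u ^ i = 0 ↔ p ^ e ∣ k := by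
  obtain ⟨x, hx, hpx, rfl⟩ := exists_int_lift_of_dvd_sub_one hp hu
  rw [← Int.prime_pow_dvd_geom_sum_iff hp hp2 hx hpx k e]
  rw [show ((p : ℤ) ^ e) = ((p ^ e : ℕ) : ℤ) by push_cast; rfl,
    ← ZMod.intCast_zmod_eq_zero_iff_dvd]
  push_cast
  rfl

theorem pow_prime_pow_pred_eq_one (hp : p.Prime) (hp2 : p ≠ 2) (he : 1 ≤ e) {u : ZMod (p ^ e)}
    (hu : (p : ZMod (p ^ e)) ∣ u - 1) : u ^ p ^ (e - 1) = 1 := by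
  obtain ⟨x, hx, hpx, rfl⟩ := exists_int_lift_of_dvd_sub_one hp hu
  have h1 := (Int.prime_pow_dvd_geom_sum_iff hp hp2 hx hpx (p ^ (e - 1)) (e - 1)).mpr dvd_rfl
  have h2 : ((p ^ e : ℕ) : ℤ) ∣ x ^ p ^ (e - 1) - 1 := by
    rw [← geom_sum_mul]
    have := mul_dvd_mul h1 hpx
    rw [← pow_succ, Nat.sub_add_cancel he] at this
    exact_mod_cast this
  rw [← ZMod.intCast_zmod_eq_zero_iff_dvd] at h2
  push_cast at h2
  exact sub_eq_zero.mp h2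

/-- An affine map `z ↦ b + u * z` of `ZMod (p ^ e)` with the same order as its linear part has a
fixed point. -/
theorem exists_fixed_point_of_geom_sum_eq_zero (hp : p.Prime) (hp2 : p ≠ 2)
    {u b : ZMod (p ^ e)} (h : b * ∑ i ∈ Finset.range (orderOf u), u ^ i = 0) :
    ∃ z, b + u * z = z := by
  suffices ∃ z, b = (1 - u) * z by
    obtain ⟨z, hz⟩ := this
    exact ⟨z, by rw [hz]; ring⟩
  have : NeZero (p ^ e) := ⟨(pow_pos hp.pos e).ne'⟩
  rcases isUnit_or_natCast_prime_dvd hp (u - 1) with h1 | h1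
  · obtain ⟨c, hc⟩ := (show IsUnit (1 - u) by simpa using h1.neg).dvd (a := b)
    exact ⟨c, hc⟩
  obtain ⟨x, hx, hpx, rfl⟩ := exists_int_lift_of_dvd_sub_one hp h1
  set r := orderOf (x : ZMod (p ^ e)) with hr
  obtain ⟨B, rfl⟩ := ZMod.intCast_surjective b
  have hB : (p : ℤ) ^ e ∣ B * ∑ i ∈ Finset.range r, x ^ i := by
    have := (ZMod.intCast_zmod_eq_zero_iff_dvd (B * ∑ i ∈ Finset.range r, x ^ i) (p ^ e)).mp
      (by push_cast; exact h)
    exact_mod_cast this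
  -- With `x - 1 = p ^ k * w`, the order of `x` is `p ^ j` with `j ≤ e - k`. The geometric sum has
  -- valuation exactly `j`, so `p ^ (e - j)` divides `B`; for `k < e` this makes `b` a multiple of
  -- `p ^ k`, hence of `u - 1`.
  obtain ⟨k, w, hw, hxw⟩ : ∃ (k : ℕ) (w : ℤ), ¬ (p : ℤ) ∣ w ∧ x - 1 = (p : ℤ) ^ k * w := by
    have hf : FiniteMultiplicity (p : ℤ) (x - 1) := by
      rw [Int.finiteMultiplicity_iff]
      exact ⟨by simpa using hp.one_lt.ne', by omega⟩
    obtain ⟨w, hw, hw'⟩ := hf.exists_eq_pow_mul_and_not_dvd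
    exact ⟨_, w, hw', hw⟩
  have hp' := Nat.prime_iff_prime_int.mp hp
  have hrd : r ∣ p ^ (e - k) := by
    rw [hr, orderOf_dvd_iff_pow_eq_one, ← sub_eq_zero]
    have h2 : ((p ^ e : ℕ) : ℤ) ∣ x ^ p ^ (e - k) - 1 := by
      rw [← geom_sum_mul]
      have h3 := mul_dvd_mul
        ((Int.prime_pow_dvd_geom_sum_iff hp hp2 hx hpx (p ^ (e - k)) (e - k)).mpr dvd_rfl)
        (Dvd.intro _ hxw.symm)
      rw [← pow_add] at h3
      push_cast
      exact (pow_dvd_pow _ (by omega)).trans h3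
    rw [← ZMod.intCast_zmod_eq_zero_iff_dvd] at h2
    push_cast at h2
    exact h2
  obtain ⟨j, hj, hrj⟩ := (Nat.dvd_prime_pow hp).mp hrd
  have hBk : (p : ℤ) ^ (e - j) ∣ B := by
    rw [hrj] at hB
    obtain ⟨s, hs⟩ := (Int.prime_pow_dvd_geom_sum_iff hp hp2 hx hpx (p ^ j) j).mpr dvd_rfl
    have hps : ¬ (p : ℤ) ∣ s := by
      rintro ⟨t, rfl⟩
      have h3 := (Int.prime_pow_dvd_geom_sum_iff hp hp2 hx hpx (p ^ j) (j + 1)).mp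
        ⟨t, by rw [hs]; ring⟩
      exact absurd ((Nat.pow_dvd_pow_iff_le_right hp.one_lt).mp h3) (by omega)
    rw [hs, show B * ((p : ℤ) ^ j * s) = (p : ℤ) ^ j * (B * s) by ring,
      show e = j + (e - j) by omega, pow_add,
      mul_dvd_mul_iff_left (pow_ne_zero _ hp'.ne_zero)] at hB
    exact hp'.pow_dvd_of_dvd_mul_right _ hps hB
  rcases le_or_gt e k with hek | hek
  · have hj0 : j = 0 := by omega
    rw [hj0, Nat.sub_zero] at hBk
    refine ⟨0, ?_⟩
    rw [mul_zero, ZMod.intCast_zmod_eq_zero_iff_dvd]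
    exact_mod_cast hBk
  · obtain ⟨c, hc⟩ := (pow_dvd_pow (p : ℤ) (show k ≤ e - j by omega)).trans hBk
    have hwu : IsUnit (w : ZMod (p ^ e)) := by
      rcases isUnit_or_natCast_prime_dvd hp (w : ZMod (p ^ e)) with h3 | ⟨t, ht⟩
      · exact h3
      · exfalso
        obtain ⟨t, rfl⟩ := ZMod.intCast_surjective t
        have h4 : ((p ^ e : ℕ) : ℤ) ∣ w - p * t := by
          rw [← ZMod.intCast_zmod_eq_zero_iff_dvd]
          push_cast
          rw [ht, sub_self]
        have h5 : (p : ℤ) ∣ w - p * t :=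
          (show (p : ℤ) ∣ ((p ^ e : ℕ) : ℤ) by push_cast; exact dvd_pow_self _ (by omega)).trans h4
        exact hw ((dvd_sub_left (Dvd.intro _ rfl)).mp h5)
    obtain ⟨d, hd⟩ := hwu.dvd (a := (c : ZMod (p ^ e)))
    refine ⟨-d, ?_⟩
    have hx1 := congrArg (Int.cast : ℤ → ZMod (p ^ e)) hxw
    push_cast at hx1
    rw [show (1 - (x : ZMod (p ^ e))) * -d = ((x : ZMod (p ^ e)) - 1) * d by ring, hx1, hc]
    push_cast
    rw [hd]
    ring

end ZMod

/-! ### Affine actions on `ZMod n` -/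

/-- The group `G` acts on `X` by affine transformations `z ↦ b + u * z`, when `X` is identified
with `ZMod n` by `θ`. -/
def IsAffineAction (n : ℕ) (G : Type*) {X : Type*} [Group G] [MulAction G X]
    (θ : ZMod n ≃ X) : Prop :=
  ∀ g : G, ∃ u b : ZMod n, ∀ z, g • θ z = θ (b + u * z)

namespace IsAffineAction

variable {n : ℕ} {G X : Type*} [Group G] [MulAction G X] {θ : ZMod n ≃ X}

/-- An affine map determines its coefficients by its values at 0 and 1, so the chosen linear parts
are automatically multiplicative. -/
theorem exists_linear_part (h : IsAffineAction n G θ) :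
    ∃ (u : G →* ZMod n) (b : G → ZMod n), ∀ g z, g • θ z = θ (b g + u g * z) := by
  choose u b hub using h
  have key : ∀ g g' z, b (g * g') + u (g * g') * z = b g + u g * (b g' + u g' * z) := by
    intro g g' z
    apply θ.injective
    rw [← hub, mul_smul, hub, hub]
  have h0 : ∀ g g', b (g * g') = b g + u g * b g' := by
    intro g g'
    simpa using key g g' 0
  have h1 : ∀ z, b 1 + u 1 * z = z := by
    intro z
    apply θ.injective
    rw [← hub, one_smul]
  refine ⟨⟨⟨u, ?_⟩, ?_⟩, b, hub⟩
  · have hb := h1 0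
    have := h1 1
    simp only [mul_zero, add_zero] at hb
    simpa [hb] using this
  · intro g g'
    have := key g g' 1
    rw [h0] at this
    linear_combination this

end IsAffineAction

section

variable {n : ℕ} {G X : Type*} [Group G] [MulAction G X] {θ : ZMod n ≃ X} {u : G →* ZMod n}
  {b : G → ZMod n} (hub : ∀ g z, g • θ z = θ (b g + u g * z))

include hub

theorem affine_translation_mul (g g' : G) : b (g * g') = b g + u g * b g' := by
  apply θ.injective
  have := hub (g * g') 0
  rw [mul_smul, hub, hub] at this
  simpa using this.symm

theorem affine_translation_pow (g : G) (k : ℕ) :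
    b (g ^ k) = b g * ∑ i ∈ Finset.range k, u g ^ i := by
  induction k with
  | zero =>
    have := affine_translation_mul hub 1 1
    simp only [mul_one, map_one, one_mul, left_eq_add] at this
    simpa using this
  | succ k ih =>
    rw [pow_succ, affine_translation_mul hub, ih, Finset.sum_range_succ, map_pow]
    ring

theorem affine_eq_one_of_trivial [FaithfulSMul G X] {g : G} (hu : u g = 1) (hb : b g = 0) :
    g = 1 := by
  apply FaithfulSMul.eq_of_smul_eq_smul (α := X)
  intro x
  obtain ⟨z, rfl⟩ := θ.surjective x
  rw [hub, hu, hb, one_smul]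
  simp

end

/-! ### Long cycles and point stabilisers in affine groups of odd prime power degree -/

section

variable {p e : ℕ} {G X : Type*} [Group G] [MulAction G X] {θ : ZMod (p ^ e) ≃ X}

/-- A transitive group of affine transformations of `ZMod (p ^ e)`, `p` odd, contains a cycle of
length `p ^ e`. -/
theorem IsAffineAction.exists_cycle (hp : p.Prime) (hp2 : p ≠ 2)
    (h : IsAffineAction (p ^ e) G θ) [MulAction.IsPretransitive G X] :
    ∃ g : G, ∀ k : ℕ, g ^ k • θ 0 = θ 0 → p ^ e ∣ k := by
  obtain ⟨u, b, hub⟩ := h.exists_linear_part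
  suffices ∃ g : G, IsUnit (b g) ∧ (p : ZMod (p ^ e)) ∣ u g - 1 by
    obtain ⟨g, hb, hu⟩ := this
    refine ⟨g, fun k hk => ?_⟩
    rw [hub, mul_zero, add_zero, affine_translation_pow hub] at hk
    rwa [θ.injective.eq_iff, hb.mul_right_eq_zero, ZMod.geom_sum_eq_zero_iff hp hp2 hu] at hk
  obtain ⟨g, hg⟩ := MulAction.exists_smul_eq G (θ 0) (θ 1)
  rw [hub, θ.injective.eq_iff, mul_zero, add_zero] at hg
  rcases ZMod.isUnit_or_natCast_prime_dvd hp (u g - 1) with h1 | h1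
  swap
  · exact ⟨g, by rw [hg]; exact isUnit_one, h1⟩
  obtain ⟨c, hc⟩ := h1.exists_right_inv
  -- Here `-c` is the fixed point of `g`. Since `h` moves it by 1, the commutator of `g` and `h` is
  -- the translation by the unit `u g - 1`.
  obtain ⟨h, hh⟩ := MulAction.exists_smul_eq G (θ (-c)) (θ (-c + 1))
  rw [hub, θ.injective.eq_iff] at hh
  refine ⟨g * h * (h * g)⁻¹, ?_, ?_⟩
  · have h2 := affine_translation_mul hub (g * h * (h * g)⁻¹) (h * g)
    have h3 : u (g * h * (h * g)⁻¹) = 1 := by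
      rw [map_mul, map_mul, mul_comm (u g), ← map_mul, ← map_mul, mul_inv_cancel, map_one]
    rw [inv_mul_cancel_right, h3, one_mul, affine_translation_mul hub g h, affine_translation_mul hub h g, hg] at h2
    have h4 : b (g * h * (h * g)⁻¹) = u g - 1 := by
      linear_combination -h2 + (u g - 1) * hh + (u h - 1) * hc
    rwa [h4]
  · have h3 : u (g * h * (h * g)⁻¹) = 1 := by
      rw [map_mul, map_mul, mul_comm (u g), ← map_mul, ← map_mul, mul_inv_cancel, map_one]
    rw [h3, sub_self]
    exact dvd_zero _

/-- Let `G` be a transitive group of affine transformations of `ZMod (p ^ e)`, `p` odd, and `H` a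
subgroup of index `p ^ e` such that some `g ∈ G` permutes the cosets of `H` in a single cycle.
Then `H` is the stabiliser of a point. -/
theorem IsAffineAction.exists_eq_stabilizer (hp : p.Prime) (hp2 : p ≠ 2) (he : 1 ≤ e)
    (h : IsAffineAction (p ^ e) G θ) [MulAction.IsPretransitive G X] [FaithfulSMul G X]
    (H : Subgroup G) (hH : H.index = p ^ e) (hg : ∃ g : G, ∀ k : ℕ, g ^ k ∈ H → p ^ e ∣ k) :
    ∃ x : X, H = MulAction.stabilizer G x := by
  obtain ⟨u, b, hub⟩ := h.exists_linear_part
  obtain ⟨g, hg⟩ := hg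
  have : NeZero (p ^ e) := ⟨(pow_pos hp.pos e).ne'⟩
  have hunit : ∀ g, IsUnit (u g) := fun g => (Group.isUnit g).map u
  -- a nontrivial translation of order `p` outside of `H`
  obtain ⟨a, hua, hpa, haH⟩ : ∃ a : G, u a = 1 ∧ (p : ZMod (p ^ e)) * b a = 0 ∧ a ∉ H := by
    have hu : (p : ZMod (p ^ e)) ∣ u (g ^ (p - 1)) - 1 := by
      rw [map_pow]
      exact ZMod.natCast_prime_dvd_pow_sub_one hp he (hunit g)
    have h1 : u ((g ^ (p - 1)) ^ p ^ (e - 1)) = 1 := by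
      rw [map_pow]
      exact ZMod.pow_prime_pow_pred_eq_one hp hp2 he hu
    -- The exponent `p - 1` makes the linear part 1 mod `p`, and `p ^ (e - 1)` then makes it 1. The
    -- product is not divisible by `p ^ e`, so this power of `g` is outside `H`.
    refine ⟨(g ^ (p - 1)) ^ p ^ (e - 1), h1, ?_, ?_⟩
    · have h2 := affine_translation_pow hub ((g ^ (p - 1)) ^ p ^ (e - 1)) p
      rw [h1] at h2
      simp only [one_pow, Finset.sum_const, Finset.card_range, nsmul_eq_mul, mul_one] at h2
      rw [mul_comm, ← h2, ← pow_mul, ← pow_succ, Nat.sub_add_cancel he,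
        affine_translation_pow hub, (ZMod.geom_sum_eq_zero_iff hp hp2 hu _).mpr dvd_rfl, mul_zero]
    · rw [← pow_mul]
      intro hm
      have h2 := hg _ hm
      rw [← Nat.sub_add_cancel he, pow_succ, mul_comm, Nat.add_sub_cancel,
        mul_dvd_mul_iff_right (pow_pos hp.pos _).ne'] at h2
      have h3 := Nat.le_of_dvd (Nat.sub_pos_of_lt hp.one_lt) h2
      have := hp.pos
      omega
  -- `H` contains no nontrivial translation
  have hinj : ∀ h ∈ H, u h = 1 → h = 1 := by
    intro h hh huh
    by_contra hne
    have hbh : b h ≠ 0 := fun h0 => hne (affine_eq_one_of_trivial hub huh h0)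
    -- Every nonzero subgroup of `ZMod (p ^ e)` contains the elements killed by `p`, so a nontrivial
    -- translation in `H` would have `a` among its powers.
    suffices ∃ j : ℕ, (j : ZMod (p ^ e)) * b h = b a by
      obtain ⟨j, hj⟩ := this
      have h2 := affine_translation_pow hub h j
      rw [huh] at h2
      simp only [one_pow, Finset.sum_const, Finset.card_range, nsmul_eq_mul, mul_one] at h2
      apply haH
      have h3 : a = h ^ j := by
        apply FaithfulSMul.eq_of_smul_eq_smul (α := X)
        intro x
        obtain ⟨z, rfl⟩ := θ.surjective x
        rw [hub, hub, h2, mul_comm (b h), hj, hua, map_pow, huh, one_pow]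
      rw [h3]
      exact H.pow_mem hh j
    have hval : (b h).val ≠ 0 := fun h0 => hbh ((ZMod.val_eq_zero _).mp h0)
    obtain ⟨k, m, hm, hkm⟩ := Nat.exists_eq_pow_mul_and_not_dvd hval p hp.one_lt.ne'
    have hke : k < e := by
      by_contra hlt
      have h4 : p ^ e ∣ (b h).val := (pow_dvd_pow p (not_lt.mp hlt)).trans (Dvd.intro _ hkm.symm)
      exact absurd (Nat.le_of_dvd (Nat.pos_of_ne_zero hval) h4) (not_le.mpr (ZMod.val_lt _))
    have hmu : IsUnit (m : ZMod (p ^ e)) := by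
      rw [ZMod.isUnit_iff_coprime]
      exact Nat.Coprime.pow_right e ((hp.coprime_iff_not_dvd.mpr hm).symm)
    have hdvd : (p : ZMod (p ^ e)) ^ k ∣ b a := by
      have h5 : p ^ (e - 1) ∣ (b a).val := by
        have h6 : p ^ e ∣ p * (b a).val := by
          rw [← ZMod.natCast_eq_zero_iff]
          push_cast
          rw [ZMod.natCast_zmod_val, hpa]
        have h7 : p * p ^ (e - 1) = p ^ e := by rw [← pow_succ', Nat.sub_add_cancel he]
        exact (mul_dvd_mul_iff_left hp.pos.ne').mp ((dvd_of_eq h7).trans h6)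
      obtain ⟨t, ht⟩ := (pow_dvd_pow p (show k ≤ e - 1 by omega)).trans h5
      refine ⟨t, ?_⟩
      have := congrArg (Nat.cast : ℕ → ZMod (p ^ e)) ht
      push_cast at this
      rwa [ZMod.natCast_zmod_val] at this
    have hbh' : b h = (p : ZMod (p ^ e)) ^ k * m := by
      have := congrArg (Nat.cast : ℕ → ZMod (p ^ e)) hkm
      push_cast at this
      rwa [ZMod.natCast_zmod_val] at this
    obtain ⟨t, ht⟩ := hdvd
    obtain ⟨s, hs⟩ := hmu.dvd (a := t)
    refine ⟨s.val, ?_⟩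
    rw [ZMod.natCast_zmod_val, hbh', ht, hs]
    ring
  -- so `H` is cyclic, generated by an affine map of the same order as its linear part
  let φ : H →* (ZMod (p ^ e))ˣ := (Units.map u).comp (toUnits.toMonoidHom.comp H.subtype)
  have hφ : ∀ h : H, ((φ h : (ZMod (p ^ e))ˣ) : ZMod (p ^ e)) = u h := fun h => rfl
  have hφinj : Function.Injective φ := by
    rw [injective_iff_map_eq_one]
    intro h hh
    exact Subtype.ext (hinj h h.2 (by rw [← hφ, hh]; rfl))
  have : IsCyclic (ZMod (p ^ e))ˣ := ZMod.isCyclic_units_of_prime_pow p hp hp2 e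
  have : IsCyclic H := isCyclic_of_injective φ hφinj
  obtain ⟨h, hgen⟩ := IsCyclic.exists_generator (α := H)
  obtain ⟨z, hz⟩ := ZMod.exists_fixed_point_of_geom_sum_eq_zero hp hp2 (u := u h) (b := b h) (by
    rw [← affine_translation_pow hub]
    have h1 : (h : G) ^ orderOf (u h) = 1 :=
      hinj _ (H.pow_mem h.2 _) (by rw [map_pow, pow_orderOf_eq_one])
    rw [h1]
    simpa using affine_translation_pow hub (1 : G) 0)
  have hle : H ≤ MulAction.stabilizer G (θ z) := by
    have hs : (h : G) ∈ MulAction.stabilizer G (θ z) := by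
      rw [MulAction.mem_stabilizer_iff, hub, hz]
    intro k hk
    obtain ⟨i, hi⟩ := Subgroup.mem_zpowers_iff.mp (hgen ⟨k, hk⟩)
    have hi' : (h : G) ^ i = k := congrArg Subtype.val hi
    rw [← hi']
    exact Subgroup.zpow_mem _ hs i
  refine ⟨θ z, ?_⟩
  have hidx : (MulAction.stabilizer G (θ z)).index = p ^ e := by
    rw [MulAction.index_stabilizer_of_transitive, ← Nat.card_congr θ, Nat.card_zmod]
  have hrel := Subgroup.relIndex_mul_index hle
  rw [hidx, hH] at hrel
  have h1 : H.relIndex (MulAction.stabilizer G (θ z)) = 1 :=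
    Nat.eq_of_mul_eq_mul_right (pow_pos hp.pos e) (by rw [hrel, one_mul])
  exact le_antisymm hle (Subgroup.relIndex_eq_one.mp h1)

end

/-! ### Transitive subgroups of the holomorph of a cyclic group -/

/-- An action by maps `x ↦ η * α(x)` on a cyclic group is an affine action. -/
theorem exists_isAffineAction {n : ℕ} {N G X : Type*} [Group N] [IsCyclic N] [Group G]
    [MulAction G X] (hn : Nat.card N = n) (π : N ≃ X)
    (h : ∀ g : G, ∃ (η : N) (α : N →* N), ∀ x, g • π x = π (η * α x)) :
    ∃ θ : ZMod n ≃ X, θ 0 = π 1 ∧ IsAffineAction n G θ := by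
  subst hn
  let f : Multiplicative (ZMod (Nat.card N)) ≃* N := zmodCyclicMulEquiv inferInstance
  refine ⟨Multiplicative.ofAdd.trans (f.toEquiv.trans π), ?_, ?_⟩
  · change π (f (Multiplicative.ofAdd 0)) = π 1
    rw [ofAdd_zero, map_one]
  · intro g
    obtain ⟨η, α, hα⟩ := h g
    -- Endomorphisms of a cyclic group are power maps; the exponent is the linear coefficient.
    obtain ⟨m, hm⟩ := MonoidHom.map_cyclic α
    refine ⟨m, Multiplicative.toAdd (f.symm η), fun z => ?_⟩
    change g • π (f (Multiplicative.ofAdd z)) = π (f (Multiplicative.ofAdd _))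
    rw [hα, hm, ofAdd_add, map_mul f, ofAdd_toAdd, f.apply_symm_apply, ← map_zpow, ← ofAdd_zsmul,
      zsmul_eq_mul]

namespace Hol

variable {N : Type*} [Group N]

theorem smul_def (g : Hol N) (x : N) : g • x = g.left * g.right x := rfl

instance : FaithfulSMul (Hol N) N where
  eq_of_smul_eq_smul {g g'} h := by
    have h1 : g.left = g'.left := by simpa [smul_def] using h 1
    refine SemidirectProduct.ext h1 (MulEquiv.ext fun x => ?_)
    have := h x
    rwa [smul_def, smul_def, h1, mul_right_inj] at this

theorem exists_isAffineAction [IsCyclic N] {n : ℕ} (hn : Nat.card N = n) (T : Subgroup (Hol N)) :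
    ∃ θ : ZMod n ≃ N, θ 0 = 1 ∧ IsAffineAction n T θ :=
  _root_.exists_isAffineAction hn (Equiv.refl N) fun g =>
    ⟨(g : Hol N).left, (g : Hol N).right.toMonoidHom, fun _ => rfl⟩

theorem subgroup_faithfulSMul (T : Subgroup (Hol N)) : FaithfulSMul T N where
  eq_of_smul_eq_smul h := Subtype.ext (FaithfulSMul.eq_of_smul_eq_smul (α := N) h)

end Hol

theorem MulAction.map_conj_stabilizer_eq {G X : Type*} [Group G] [MulAction G X] (g : G) (x : X) :
    (MulAction.stabilizer G x).map (MulAut.conj g).toMonoidHom = MulAction.stabilizer G (g • x) :=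
  (MulAction.stabilizer_smul_eq_stabilizer_map_conj g x).symm

theorem MulAction.normalCore_stabilizer_eq_bot {G X : Type*} [Group G] [MulAction G X]
    [MulAction.IsPretransitive G X] [FaithfulSMul G X] (x : X) :
    (MulAction.stabilizer G x).normalCore = ⊥ := by
  rw [eq_bot_iff]
  intro g hg
  rw [Subgroup.mem_bot]
  apply FaithfulSMul.eq_of_smul_eq_smul (α := X)
  intro y
  obtain ⟨h, rfl⟩ := MulAction.exists_smul_eq G x y
  have h1 : h⁻¹ * g * h⁻¹⁻¹ ∈ MulAction.stabilizer G x :=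
    Subgroup.normalCore_le _ ((Subgroup.normalCore_normal _).conj_mem g hg h⁻¹)
  rw [MulAction.mem_stabilizer_iff, inv_inv, mul_smul, mul_smul, inv_smul_eq_iff] at h1
  rw [h1, one_smul]

theorem isTransitiveInHol_quotient_iff {p e : ℕ} (hp : p.Prime) (hp2 : p ≠ 2) (he : 1 ≤ e)
    {N : Type*} [Group N] [IsCyclic N] (hN : Nat.card N = p ^ e) (G : Subgroup (Hol N))
    [MulAction.IsPretransitive G N] (H : Subgroup G) (hH : H.index = p ^ e) :
    IsTransitiveInHol N (G ⧸ H.normalCore) (H.map (QuotientGroup.mk' H.normalCore)) ↔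
      ∃ g : G, H.map (MulAut.conj g).toMonoidHom = MulAction.stabilizer G (1 : N) := by
  have := Hol.subgroup_faithfulSMul G
  constructor
  · rintro ⟨T, hT, f, hf⟩
    obtain ⟨θ', hθ', hT'⟩ := Hol.exists_isAffineAction hN T
    obtain ⟨t, ht⟩ := hT'.exists_cycle hp hp2
    obtain ⟨θ, -, hG⟩ := Hol.exists_isAffineAction hN G
    obtain ⟨g, hg⟩ := QuotientGroup.mk_surjective (f.symm t)
    -- As `f` matches `H/C` with the stabiliser of 1, a power of the lift `g` lies in `H` only if
    -- the same power of the cycle `t` fixes 1.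
    obtain ⟨x, hx⟩ := hG.exists_eq_stabilizer hp hp2 he H hH ⟨g, fun k hk => ht k (by
      rw [hθ', ← MulAction.mem_stabilizer_iff, ← hf]
      refine ⟨f.symm (t ^ k), ⟨g ^ k, hk, ?_⟩, by simp⟩
      rw [QuotientGroup.mk'_apply, QuotientGroup.mk_pow, hg, map_pow])⟩
    obtain ⟨g, hg⟩ := MulAction.exists_smul_eq G x 1
    exact ⟨g, by rw [hx, MulAction.map_conj_stabilizer_eq, hg]⟩
  · rintro ⟨g, hg⟩
    have hH' : H = MulAction.stabilizer G (g⁻¹ • (1 : N)) := by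
      rw [← MulAction.map_conj_stabilizer_eq, ← hg, Subgroup.map_map]
      convert! H.map_id.symm
      ext x : 1
      simp [mul_assoc]
    have hcore : H.normalCore = ⊥ := by
      rw [hH']
      exact MulAction.normalCore_stabilizer_eq_bot _
    let f : G ⧸ H.normalCore ≃* G :=
      ((QuotientGroup.quotientMulEquivOfEq hcore).trans QuotientGroup.quotientBot).trans
        (MulAut.conj g)
    refine ⟨G, ‹_›, f, ?_⟩
    rw [Subgroup.map_map, ← hg]
    rfl

/-! ### Base change of group-like elements -/

section

variable {K H F F' : Type*} [Field K] [Ring H] [HopfAlgebra K H] [Field F] [Algebra K F] [Field F']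
  [Algebra K F']

/-- The `φ`-semilinear map `F ⊗ H → F' ⊗ H` induced by an embedding of fields `φ : F → F'`. -/
noncomputable def semilinearBaseChange (H : Type*) [Ring H] [HopfAlgebra K H] (φ : F →ₐ[K] F') :
    (F ⊗[K] H) →ₛₗ[(φ : F →+* F')] (F' ⊗[K] H) where
  toFun := Algebra.TensorProduct.map φ (AlgHom.id K H)
  map_add' := map_add _
  map_smul' c y := by
    induction y with
    | zero => simp
    | add y z hy hz => rw [smul_add, map_add, hy, hz, map_add, smul_add]
    | tmul a h => simp [TensorProduct.smul_tmul']

theorem semilinearBaseChange_apply (φ : F →ₐ[K] F') (y : F ⊗[K] H) :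
    semilinearBaseChange H φ y = Algebra.TensorProduct.map φ (AlgHom.id K H) y := rfl

@[simp]
theorem semilinearBaseChange_tmul (φ : F →ₐ[K] F') (a : F) (h : H) :
    semilinearBaseChange H φ (a ⊗ₜ h) = φ a ⊗ₜ h := rfl

theorem comul_semilinearBaseChange (φ : F →ₐ[K] F') (y : F ⊗[K] H) :
    Coalgebra.comul (R := F') (semilinearBaseChange H φ y) =
      TensorProduct.map (semilinearBaseChange H φ) (semilinearBaseChange H φ)
        (Coalgebra.comul (R := F) y) := by
  induction y with
  | zero => simp
  | add y z hy hz => simp only [map_add, hy, hz]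
  | tmul a h =>
    rw [semilinearBaseChange_tmul, TensorProduct.comul_tmul, TensorProduct.comul_tmul,
      CommSemiring.comul_apply, CommSemiring.comul_apply]
    generalize Coalgebra.comul (R := K) h = t
    induction t with
    | zero => simp
    | add y z hy hz => simp only [TensorProduct.tmul_add, map_add, hy, hz]
    | tmul h₁ h₂ => simp

theorem counit_semilinearBaseChange (φ : F →ₐ[K] F') (y : F ⊗[K] H) :
    Coalgebra.counit (R := F') (semilinearBaseChange H φ y) =
      φ (Coalgebra.counit (R := F) y) := by
  induction y with
  | zero => simp
  | add y z hy hz => simp only [map_add, hy, hz]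
  | tmul a h => simp

theorem IsGroupLikeElem.semilinearBaseChange (φ : F →ₐ[K] F') {y : F ⊗[K] H}
    (hy : IsGroupLikeElem F y) : IsGroupLikeElem F' (semilinearBaseChange H φ y) where
  counit_eq_one := by rw [counit_semilinearBaseChange, hy.counit_eq_one, map_one]
  comul_eq_tmul_self := by
    rw [comul_semilinearBaseChange, hy.comul_eq_tmul_self, TensorProduct.map_tmul]

end

/-! ### Points and group-like elements -/

namespace HopfGaloisStructure

variable {K L H : Type*} [Field K] [Field L] [Algebra K L] [Ring H] [HopfAlgebra K H]
  (S : HopfGaloisStructure K L H) {E : Type*} [Field E] [Algebra K E]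

/-- The map `E ⊗ H → Hom_K(L, E)`, `a ⊗ h ↦ (l ↦ a * x (h · l))`. -/
noncomputable def translate (x : L →ₐ[K] E) : E ⊗[K] H →ₗ[E] (L →ₗ[K] E) :=
  LinearMap.liftBaseChange E ((LinearMap.compRight K x.toLinearMap) ∘ₗ S.act.toLinearMap)

@[simp]
theorem translate_tmul (x : L →ₐ[K] E) (a : E) (h : H) (l : L) :
    S.translate x (a ⊗ₜ h) l = a * x (S.act h l) := by
  simp [translate]

theorem translate_apply_one (x : L →ₐ[K] E) (y : E ⊗[K] H) :
    S.translate x y 1 = Coalgebra.counit (R := E) y := by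
  induction y with
  | zero => simp
  | add y z hy hz => simp only [map_add, LinearMap.add_apply, hy, hz]
  | tmul a h => simp [S.act_one, Algebra.smul_def, mul_comm]

theorem translate_apply_mul (x : L →ₐ[K] E) (y : E ⊗[K] H) (l l' : L) :
    S.translate x y (l * l') = LinearMap.mul' E E
      (TensorProduct.map ((S.translate x).flip l) ((S.translate x).flip l')
        (Coalgebra.comul (R := E) y)) := by
  induction y with
  | zero => simp
  | add y z hy hz => simp only [map_add, LinearMap.add_apply, hy, hz]
  | tmul a h =>
    rw [translate_tmul, S.act_mul, TensorProduct.comul_tmul, CommSemiring.comul_apply]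
    generalize Coalgebra.comul (R := K) h = t
    induction t with
    | zero => simp
    | add y z hy hz => simp only [TensorProduct.tmul_add, map_add, mul_add, hy, hz]
    | tmul h₁ h₂ =>
      simp [LinearMap.flip_apply]
      ring

/-- A group-like element of `E ⊗ H` translates the `E`-points of `L`. -/
noncomputable def translateAlgHom (x : L →ₐ[K] E) (y : E ⊗[K] H) (hy : IsGroupLikeElem E y) :
    L →ₐ[K] E :=
  AlgHom.ofLinearMap (S.translate x y)
    (by rw [translate_apply_one, hy.counit_eq_one])
    (fun l l' => by
      rw [translate_apply_mul, hy.comul_eq_tmul_self]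
      simp [LinearMap.flip_apply])

@[simp]
theorem translateAlgHom_apply (x : L →ₐ[K] E) (y : E ⊗[K] H) (hy : IsGroupLikeElem E y) (l : L) :
    S.translateAlgHom x y hy l = S.translate x y l := rfl

theorem translate_mul_tmul (x : L →ₐ[K] E) (y : E ⊗[K] H) (a : E) (h : H) (l : L) :
    S.translate x (y * a ⊗ₜ h) l = a * S.translate x y (S.act h l) := by
  induction y with
  | zero => simp
  | add y z hy hz => simp only [map_add, LinearMap.add_apply, add_mul, mul_add, hy, hz]
  | tmul b k =>
    simp only [Algebra.TensorProduct.tmul_mul_tmul, translate_tmul, map_mul, Module.End.mul_apply]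
    ring

/-- Translation is a right action of group-like elements, so the point labelled `η * ξ` is the
translate by `ξ` of the point labelled `η`. -/
theorem translate_translateAlgHom (x : L →ₐ[K] E) (y : E ⊗[K] H) (hy : IsGroupLikeElem E y)
    (z : E ⊗[K] H) : S.translate (S.translateAlgHom x y hy) z = S.translate x (y * z) := by
  ext l
  induction z with
  | zero => simp
  | add z w hz hw => simp only [map_add, LinearMap.add_apply, mul_add, hz, hw]
  | tmul a h => rw [translate_tmul, translate_mul_tmul, translateAlgHom_apply]

theorem translate_semilinearBaseChange {E' : Type*} [Field E'] [Algebra K E'] (φ : E →ₐ[K] E')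
    (x : L →ₐ[K] E) (y : E ⊗[K] H) (l : L) :
    S.translate (φ.comp x) (semilinearBaseChange H φ y) l = φ (S.translate x y l) := by
  induction y with
  | zero => simp
  | add y z hy hz => simp only [map_add, LinearMap.add_apply, hy, hz]
  | tmul a h => simp

include S in
theorem finrank_eq [FiniteDimensional K L] : Module.finrank K H = Module.finrank K L := by
  have := S.finite
  have h1 := (LinearEquiv.ofBijective _ S.galois).finrank_eq
  rw [Module.finrank_tensorProduct, Module.finrank_linearMap] at h1
  exact Nat.eq_of_mul_eq_mul_left Module.finrank_pos h1

theorem translate_surjective [FiniteDimensional K L] (x : L →ₐ[K] E) :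
    Function.Surjective (S.translate x) := by
  -- the image contains `x ∘ f` for every `f ∈ End_K(L)`
  have h1 : ∀ f : Module.End K L, x.toLinearMap ∘ₗ f ∈ LinearMap.range (S.translate x) := by
    intro f
    obtain ⟨t, rfl⟩ := S.galois.2 f
    induction t with
    | zero => simp
    | add y z hy hz =>
      rw [map_add, LinearMap.comp_add]
      exact add_mem hy hz
    | tmul l h => exact ⟨x l ⊗ₜ h, by ext; simp⟩
  intro f
  let b := Module.finBasis K L
  have h2 : f = ∑ i, f (b i) • (x.toLinearMap ∘ₗ (b.coord i).smulRight (1 : L)) := by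
    apply b.ext
    intro j
    simp [LinearMap.sum_apply, Finsupp.single_apply, apply_ite x]
  rw [← LinearMap.mem_range, h2]
  exact Submodule.sum_mem _ fun i _ => Submodule.smul_mem _ _ (h1 _)

theorem translate_injective [FiniteDimensional K L] (x : L →ₐ[K] E) :
    Function.Injective (S.translate x) := by
  have := S.finite
  rw [LinearMap.injective_iff_surjective_of_finrank_eq_finrank]
  · exact S.translate_surjective x
  · rw [Module.finrank_baseChange, S.finrank_eq, Module.finrank_linearMap_self]

include S in
/-- A Hopf-Galois structure of type `N` makes `N` act simply transitively on the `E`-points of `L`,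
and this action is normalised by the automorphisms of `E`. -/
theorem exists_equiv_algHom [FiniteDimensional K L]
    (hcard : Nat.card (L →ₐ[K] E) = Module.finrank K L) {N : Type*} [Group N]
    (e : (E ⊗[K] H) ≃ₐc[E] MonoidAlgebra E N) (x : L →ₐ[K] E) :
    ∃ π : N ≃ (L →ₐ[K] E), π 1 = x ∧ ∀ σ : E ≃ₐ[K] E, ∃ (η : N) (α : N →* N),
      ∀ ζ, (σ : E →ₐ[K] E).comp (π ζ) = π (η * α ζ) := by
  have hHfin := S.finite
  let g : N → E ⊗[K] H := fun ζ => e.symm (MonoidAlgebra.of E N ζ)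
  have hg : ∀ ζ, IsGroupLikeElem E (g ζ) := fun ζ =>
    (isGroupLikeElem_map_equiv e.symm).mpr (MonoidAlgebra.isGroupLikeElem_of ζ)
  have hg_mul : ∀ ζ ξ, g (ζ * ξ) = g ζ * g ξ := fun ζ ξ => by simp only [g, map_mul]
  have hg_one : g 1 = 1 := by simp only [g, map_one]
  have hg_inj : Function.Injective g := e.symm.injective.comp MonoidAlgebra.of_injective
  have hg_surj : ∀ y, IsGroupLikeElem E y → ∃ ζ, g ζ = y := by
    intro y hy
    obtain ⟨ζ, hζ⟩ := MonoidAlgebra.isGroupLikeElem_iff_mem_range_of.mp (hy.map e)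
    exact ⟨ζ, by simp only [g, hζ, BialgEquiv.symm_apply_apply]⟩
  let π : N → (L →ₐ[K] E) := fun ζ => S.translateAlgHom x (g ζ) (hg ζ)
  have hπ_inj : Function.Injective π := by
    intro ζ ξ h
    apply hg_inj
    apply S.translate_injective x
    ext l
    exact DFunLike.congr_fun h l
  have hN : Nat.card N = Module.finrank K L := by
    have h1 := (e : (E ⊗[K] H) ≃ₐ[E] MonoidAlgebra E N).toLinearEquiv.finrank_eq
    rw [Module.finrank_baseChange, S.finrank_eq] at h1
    rw [h1, (MonoidAlgebra.coeffLinearEquiv E : MonoidAlgebra E N ≃ₗ[E] _).finrank_eq,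
      Module.finrank, rank_finsupp_self, Cardinal.toNat_lift, Nat.card]
  have : Finite (L →ₐ[K] E) := Nat.finite_of_card_ne_zero (by
    rw [hcard]
    exact Module.finrank_pos.ne')
  have hπ : Function.Bijective π :=
    (Nat.bijective_iff_injective_and_card π).mpr ⟨hπ_inj, by rw [hN, hcard]⟩
  refine ⟨Equiv.ofBijective π hπ, ?_, fun σ => ?_⟩
  · ext l
    change S.translate x (g 1) l = x l
    rw [hg_one, Algebra.TensorProduct.one_def, translate_tmul, map_one, one_mul,
      Module.End.one_apply]
  · have hσ : ∀ ζ, ∃ ξ, g ξ = semilinearBaseChange H (σ : E →ₐ[K] E) (g ζ) := fun ζ =>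
      hg_surj _ ((hg ζ).semilinearBaseChange _)
    choose α hα using hσ
    -- `η` labels the image of the base point and `α` is the effect of `σ` on group-like elements,
    -- so `σ (x · ζ) = (σ x) · (σ ζ) = x · (η * α ζ)`.
    obtain ⟨η, hη⟩ := hπ.2 ((σ : E →ₐ[K] E).comp x)
    refine ⟨η, ⟨⟨α, ?_⟩, ?_⟩, ?_⟩
    · apply hg_inj
      rw [hα, hg_one, semilinearBaseChange_apply, map_one]
    · intro ζ ξ
      apply hg_inj
      rw [hα, hg_mul, hg_mul, hα, hα, semilinearBaseChange_apply, map_mul]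
      rfl
    · intro ζ
      ext l
      change σ (S.translate x (g ζ) l) = S.translate x (g (η * α ζ)) l
      rw [hg_mul, ← S.translate_translateAlgHom x (g η) (hg η), hα]
      change _ = S.translate (π η) _ l
      rw [hη, translate_semilinearBaseChange]
      rfl

end HopfGaloisStructure

/-! ### Transport of Hopf-Galois structures -/

/-- Transport of a Hopf-Galois structure along an isomorphism of extensions of `K`. -/
noncomputable def HopfGaloisStructure.transport {K L L' H : Type*} [Field K] [Field L] [Field L']
    [Algebra K L] [Algebra K L'] [Ring H] [HopfAlgebra K H] (S : HopfGaloisStructure K L H)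
    (φ : L ≃ₐ[K] L') : HopfGaloisStructure K L' H where
  finite := S.finite
  cocomm := S.cocomm
  act := (φ.toLinearEquiv.conjAlgEquiv K).toAlgHom.comp S.act
  act_one h := by
    change φ (S.act h (φ.symm 1)) = _
    rw [map_one, S.act_one, AlgEquiv.commutes]
  act_mul h x y := by
    change φ (S.act h (φ.symm (x * y))) = _
    rw [map_mul, S.act_mul]
    generalize Coalgebra.comul (R := K) h = t
    induction t with
    | zero => simp
    | add s t hs ht => simp only [map_add, hs, ht]
    | tmul h₁ h₂ =>
      simp only [TensorProduct.map_tmul, LinearMap.mul'_apply, map_mul]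
      rfl
  galois := by
    have h : ∀ t : L ⊗[K] H,
        (LinearMap.mul' K (Module.End K L') ∘ₗ TensorProduct.map (Algebra.lmul K L').toLinearMap
          ((φ.toLinearEquiv.conjAlgEquiv K).toAlgHom.comp S.act).toLinearMap)
          (TensorProduct.congr φ.toLinearEquiv (LinearEquiv.refl K H) t) =
        φ.toLinearEquiv.conjAlgEquiv K ((LinearMap.mul' K (Module.End K L) ∘ₗ
          TensorProduct.map (Algebra.lmul K L).toLinearMap S.act.toLinearMap) t) := by
      intro t
      induction t with
      | zero => simp
      | add s t hs ht => simp only [map_add, hs, ht]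
      | tmul l h =>
        ext y
        change φ l * φ (S.act h (φ.symm y)) = φ (l * S.act h (φ.symm y))
        rw [map_mul]
    rw [← Function.Bijective.of_comp_iff _
      (TensorProduct.congr φ.toLinearEquiv (LinearEquiv.refl K H)).bijective]
    have h' := (φ.toLinearEquiv.conjAlgEquiv K).bijective.comp S.galois
    convert! h' using 1
    exact funext h

/-- The type of a Hopf algebra does not depend on the choice of the splitting field up to
isomorphism. -/
theorem nonempty_bialgEquiv_of_algEquiv {K F F' H N : Type*} [Field K] [Field F] [Field F']
    [Algebra K F] [Algebra K F'] [Ring H] [HopfAlgebra K H] [Group N] (ψ : F ≃ₐ[K] F')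
    (e : (F ⊗[K] H) ≃ₐc[F] MonoidAlgebra F N) :
    Nonempty ((F' ⊗[K] H) ≃ₐc[F'] MonoidAlgebra F' N) := by
  -- Since `s` is only semilinear, the isomorphism is rebuilt from the images of `N`: they are
  -- group-like, hence linearly independent, and they span because `s` is onto.
  let s := semilinearBaseChange H (ψ : F →ₐ[K] F')
  let g : N →* F' ⊗[K] H :=
    { toFun := fun ζ => s (e.symm (MonoidAlgebra.of F N ζ))
      map_one' := by
        simp only [map_one, s, semilinearBaseChange_apply]
      map_mul' := fun ζ ξ => by
        simp only [map_mul, s, semilinearBaseChange_apply] }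
  have hg : ∀ ζ, IsGroupLikeElem F' (g ζ) := fun ζ =>
    ((isGroupLikeElem_map_equiv e.symm).mpr
      (MonoidAlgebra.isGroupLikeElem_of ζ)).semilinearBaseChange _
  have hs_surj : Function.Surjective s := by
    intro y
    induction y with
    | zero => exact ⟨0, map_zero _⟩
    | add y z hy hz =>
      obtain ⟨y, rfl⟩ := hy
      obtain ⟨z, rfl⟩ := hz
      exact ⟨y + z, map_add _ _ _⟩
    | tmul a h => exact ⟨ψ.symm a ⊗ₜ h, by
      rw [semilinearBaseChange_tmul, AlgEquiv.coe_toAlgHom, AlgEquiv.apply_symm_apply]⟩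
  have hs_inj : Function.Injective s := by
    have h1 : ∀ y, semilinearBaseChange H (ψ.symm : F' →ₐ[K] F) (s y) = y := by
      intro y
      induction y with
      | zero => rw [map_zero s, map_zero]
      | add y z hy hz => rw [map_add s, map_add, hy, hz]
      | tmul a h =>
        rw [semilinearBaseChange_tmul, semilinearBaseChange_tmul, AlgEquiv.coe_toAlgHom,
          AlgEquiv.coe_toAlgHom, AlgEquiv.symm_apply_apply]
    exact Function.LeftInverse.injective h1
  have hg_inj : Function.Injective g :=
    hs_inj.comp (e.symm.injective.comp MonoidAlgebra.of_injective)
  let f : MonoidAlgebra F' N →ₐc[F'] (F' ⊗[K] H) :=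
    BialgHom.ofAlgHom (MonoidAlgebra.lift F' (F' ⊗[K] H) N g)
      (by ext ζ; simp [(hg ζ).counit_eq_one]) (by ext ζ; simp [(hg ζ).comul_eq_tmul_self])
  have hf : ∀ w, f w = MonoidAlgebra.lift F' (F' ⊗[K] H) N g w := fun w => rfl
  refine ⟨(BialgEquiv.ofBijective f ⟨?_, ?_⟩).symm⟩
  · have h1 : LinearIndependent F' g :=
      (linearIndep_groupLikeVal (R := F') (A := F' ⊗[K] H)).comp
        (fun ζ => ⟨g ζ, hg ζ⟩) (fun ζ ξ h => hg_inj (congrArg GroupLike.val h))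
    intro w w' hw
    apply (MonoidAlgebra.coeffLinearEquiv F' : MonoidAlgebra F' N ≃ₗ[F'] _).injective
    apply h1
    rw [hf, hf, MonoidAlgebra.lift_apply, MonoidAlgebra.lift_apply] at hw
    exact hw
  · intro y
    obtain ⟨y, rfl⟩ := hs_surj y
    obtain ⟨w, rfl⟩ := e.symm.surjective y
    change s (e.symm w) ∈ Set.range f
    induction w using MonoidAlgebra.induction_linear with
    | zero => exact ⟨0, by rw [map_zero, map_zero, map_zero s]⟩
    | add w w' hw hw' =>
      obtain ⟨a, ha⟩ := hw
      obtain ⟨b, hb⟩ := hw'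
      exact ⟨a + b, by rw [map_add, map_add, map_add s, ha, hb]⟩
    | single ζ c =>
      refine ⟨MonoidAlgebra.single ζ (ψ c), ?_⟩
      rw [hf, MonoidAlgebra.lift_single,
        show MonoidAlgebra.single ζ c = c • MonoidAlgebra.of F N ζ by simp, map_smul,
        LinearMap.map_smulₛₗ]
      rfl

theorem isNormalClosure_normalClosure_algebraicClosure (K L : Type*) [Field K] [Field L]
    [Algebra K L] [Algebra.IsAlgebraic K L] : IsNormalClosure K L (NormalClosure K L) :=
  Algebra.IsAlgebraic.isNormalClosure_normalClosure fun _ => IsAlgClosed.splits _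

theorem IsNormalClosure.of_algEquiv {K L L' E : Type*} [Field K] [Field L] [Field L'] [Field E]
    [Algebra K L] [Algebra K L'] [Algebra K E] (φ : L ≃ₐ[K] L') [h : IsNormalClosure K L E] :
    IsNormalClosure K L' E where
  splits x := by
    rw [← minpoly.algEquiv_eq φ.symm x]
    exact h.splits _
  adjoin_rootSet := by
    rw [← h.adjoin_rootSet, ← φ.toEquiv.iSup_comp]
    refine iSup_congr fun x => ?_
    rw [← minpoly.algEquiv_eq φ x]
    rfl

theorem AdmitsHopfGaloisOfCyclicType.of_algEquiv {K : Type u} {L L' : Type v} [Field K] [Field L]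
    [Field L'] [Algebra K L] [Algebra K L'] [Algebra.IsAlgebraic K L] (φ : L ≃ₐ[K] L')
    (h : AdmitsHopfGaloisOfCyclicType K L) : AdmitsHopfGaloisOfCyclicType K L' := by
  obtain ⟨N, hN, hcyc, H, hH, hH', ⟨S⟩, ⟨e⟩⟩ := h
  have := isNormalClosure_normalClosure_algebraicClosure K L
  have : IsNormalClosure K L' (NormalClosure K L) := IsNormalClosure.of_algEquiv φ
  have : Algebra.IsAlgebraic K L' := φ.isAlgebraic
  have := isNormalClosure_normalClosure_algebraicClosure K L'
  have ψ : NormalClosure K L ≃ₐ[K] NormalClosure K L' := IsNormalClosure.equiv (K := L')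
  exact ⟨N, hN, hcyc, H, hH, hH', ⟨S.transport φ⟩, nonempty_bialgEquiv_of_algEquiv ψ e⟩

/-! ### The action of the Galois group on embeddings -/

section

variable {K L E : Type*} [Field K] [Field L] [Field E] [Algebra K L] [Algebra K E]

/-- The automorphisms of `E` act on the embeddings of `L` into `E`. -/
instance AlgEquiv.mulActionAlgHom : MulAction (E ≃ₐ[K] E) (L →ₐ[K] E) where
  smul σ x := (σ : E →ₐ[K] E).comp x
  one_smul _ := rfl
  mul_smul _ _ _ := rfl

theorem AlgEquiv.isPretransitive_algHom [Normal K E] :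
    MulAction.IsPretransitive (E ≃ₐ[K] E) (L →ₐ[K] E) where
  exists_smul_eq x y := by
    let := x.toRingHom.toAlgebra
    have : IsScalarTower K L E := IsScalarTower.of_algHom x
    refine ⟨AlgEquiv.ofBijective (y.liftNormal E) (AlgHom.normal_bijective K E E _), ?_⟩
    ext l
    exact y.liftNormal_commutes E l

/-- The images of the embeddings of `L` generate `E`, so an automorphism fixing every embedding is
trivial. -/
theorem AlgEquiv.faithfulSMul_algHom [Algebra.IsAlgebraic K L] [h : IsNormalClosure K L E] :
    FaithfulSMul (E ≃ₐ[K] E) (L →ₐ[K] E) where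
  eq_of_smul_eq_smul {σ τ} hστ := by
    have htop := (Algebra.IsAlgebraic.isNormalClosure_iff.mp h).2
    have hle : IntermediateField.normalClosure K L E ≤
        IntermediateField.fixedField (Subgroup.zpowers (τ⁻¹ * σ)) := by
      rw [normalClosure_le_iff]
      rintro f _ ⟨l, rfl⟩
      rw [IntermediateField.mem_fixedField_iff]
      intro ρ hρ
      have h1 : τ⁻¹ * σ ∈ MulAction.stabilizer (E ≃ₐ[K] E) f := by
        rw [MulAction.mem_stabilizer_iff, mul_smul, hστ, inv_smul_smul]
      have h2 := (Subgroup.zpowers_le.mpr h1) hρ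
      exact DFunLike.congr_fun h2 l
    have h3 : τ⁻¹ * σ = 1 := by
      ext z
      have hz : z ∈ IntermediateField.fixedField (Subgroup.zpowers (τ⁻¹ * σ)) :=
        hle (htop ▸ IntermediateField.mem_top)
      exact (IntermediateField.mem_fixedField_iff _ _).mp hz _ (Subgroup.mem_zpowers _)
    exact (inv_mul_eq_one.mp h3).symm

theorem AlgEquiv.stabilizer_val (L : IntermediateField K E) :
    MulAction.stabilizer (E ≃ₐ[K] E) L.val = L.fixingSubgroup := by
  ext σ
  rw [MulAction.mem_stabilizer_iff, IntermediateField.mem_fixingSubgroup_iff, DFunLike.ext_iff]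
  exact ⟨fun h l hl => h ⟨l, hl⟩, fun h l => h l l.2⟩

theorem IsNormalClosure.finiteDimensional [FiniteDimensional K L] [h : IsNormalClosure K L E] :
    FiniteDimensional K E := by
  have htop := (Algebra.IsAlgebraic.isNormalClosure_iff.mp h).2
  have := normalClosure.is_finiteDimensional K L E
  rw [htop] at this
  exact (IntermediateField.topEquiv : _ ≃ₐ[K] E).toLinearEquiv.finiteDimensional

theorem IsNormalClosure.isGalois [Algebra.IsSeparable K L] [h : IsNormalClosure K L E] :
    IsGalois K E := by
  have := h.normal
  have htop := (Algebra.IsAlgebraic.isNormalClosure_iff.mp h).2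
  have h1 : ∀ f : L →ₐ[K] E, Algebra.IsSeparable K f.fieldRange := fun f =>
    AlgEquiv.Algebra.isSeparable (AlgEquiv.ofInjectiveField f)
  have h2 : Algebra.IsSeparable K (IntermediateField.normalClosure K L E) :=
    IntermediateField.isSeparable_iSup K E
  rw [htop] at h2
  have := AlgEquiv.Algebra.isSeparable (IntermediateField.topEquiv : _ ≃ₐ[K] E)
  exact IsGalois.mk

/-- If `L/K` admits a Hopf-Galois structure of cyclic type, then the automorphisms of a normal
extension act affinely on the embeddings of `L`. -/
theorem AdmitsHopfGaloisOfCyclicType.exists_isAffineAction [FiniteDimensional K L]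
    [Algebra.IsSeparable K L] [Normal K E] (h : AdmitsHopfGaloisOfCyclicType K L) {n : ℕ}
    (hn : Module.finrank K L = n) (x : L →ₐ[K] E) :
    ∃ θ : ZMod n ≃ (L →ₐ[K] E), θ 0 = x ∧ IsAffineAction n (E ≃ₐ[K] E) θ := by
  subst hn
  obtain ⟨N, hN, hcyc, H, hH, hH', ⟨S⟩, ⟨e⟩⟩ := h
  have hnc := isNormalClosure_normalClosure_algebraicClosure K L
  have := hnc.normal
  have hE : ∀ l : L, ((minpoly K l).map (algebraMap K E)).Splits := fun l => by
    rw [← minpoly.algHom_eq x x.injective]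
    exact Normal.splits ‹_› _
  let ι : NormalClosure K L →ₐ[K] E := IsNormalClosure.lift hE
  have hcard := AlgHom.natCard_of_splits K L (NormalClosure K L) hnc.splits
  have hcardE := AlgHom.natCard_of_splits K L E hE
  have : Finite (L →ₐ[K] E) := Nat.finite_of_card_ne_zero (by
    rw [hcardE]
    exact Module.finrank_pos.ne')
  -- Counting shows that every embedding of `L` into `E` factors through the normal closure used to
  -- define the type.
  have hc : Function.Bijective (fun y : L →ₐ[K] NormalClosure K L => ι.comp y) :=
    (Nat.bijective_iff_injective_and_card _).mpr
      ⟨fun y z hyz => AlgHom.ext fun l => ι.injective (DFunLike.congr_fun hyz l),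
        by rw [hcard, hcardE]⟩
  obtain ⟨y, hy⟩ := hc.2 x
  obtain ⟨π, hπ, hσ⟩ := S.exists_equiv_algHom hcard e y
  have hcardN : Nat.card N = Module.finrank K L := by rw [Nat.card_congr π, hcard]
  rw [← hy, ← hπ]
  refine _root_.exists_isAffineAction hcardN (π.trans (Equiv.ofBijective _ hc)) fun σ => ?_
  let := ι.toRingHom.toAlgebra
  have : IsScalarTower K (NormalClosure K L) E := IsScalarTower.of_algHom ι
  obtain ⟨η, α, hα⟩ := hσ (σ.restrictNormal (NormalClosure K L))
  refine ⟨η, α, fun ζ => ?_⟩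
  change (σ : E →ₐ[K] E).comp (ι.comp (π ζ)) = ι.comp (π (η * α ζ))
  rw [← hα]
  ext l
  exact (σ.restrictNormal_commutes (NormalClosure K L) (π ζ l)).symm

end

/-! ### The main theorem -/

theorem theorem1p1 :
    (∀ (K : Type u) (E : Type v) [Field K] [Field E] [Algebra K E]
        (L : IntermediateField K E) [FiniteDimensional K L] [Algebra.IsSeparable K L]
        [IsNormalClosure K L E],
        IsPrimePow (Module.finrank K L) → Odd (Module.finrank K L) →
        AdmitsHopfGaloisOfCyclicType K L →
        ∀ L' : IntermediateField K E, IsParallel L L' →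
          (AdmitsHopfGaloisOfCyclicType K L' ↔ IsConjugateField L L')) ∧
    (∀ (p e : ℕ), p.Prime → p ≠ 2 → 1 ≤ e →
        ∀ (N : Type w) [Group N] [IsCyclic N], Nat.card N = p ^ e →
        ∀ G : Subgroup (Hol N), MulAction.IsPretransitive G N →
        ∀ H : Subgroup G, H.index = p ^ e →
          (IsTransitiveInHol N (G ⧸ H.normalCore) (H.map (QuotientGroup.mk' H.normalCore)) ↔
            ∃ g : G, H.map (MulAut.conj g).toMonoidHom = MulAction.stabilizer G (1 : N))) := by
  refine ⟨?_, fun p e hp hp2 he N _ _ hN G hG H hH =>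
    isTransitiveInHol_quotient_iff hp hp2 he hN G H hH⟩
  intro K E _ _ _ L _ _ _ hpow hodd hL L' hpar
  constructor
  · intro hL'
    obtain ⟨p, e, hp, he, hpe⟩ := (isPrimePow_nat_iff _).mp hpow
    have hp2 : p ≠ 2 := by
      rintro rfl
      rw [← hpe, Nat.odd_pow_iff he.ne'] at hodd
      exact absurd hodd (by decide)
    have hpar' : Module.finrank K L' = p ^ e := by rw [hpar, hpe]
    have := IsNormalClosure.finiteDimensional (K := K) (L := L) (E := E)
    have := IsNormalClosure.isGalois (K := K) (L := L) (E := E)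
    have : Algebra.IsSeparable K L' := Algebra.IsSeparable.of_algHom K E L'.val
    have := AlgEquiv.isPretransitive_algHom (K := K) (L := L) (E := E)
    -- The normal closure of `L'` may be smaller than `E`, so the action on its embeddings need not
    -- be faithful; transitivity suffices to produce the cycle.
    have := AlgEquiv.isPretransitive_algHom (K := K) (L := L') (E := E)
    have := AlgEquiv.faithfulSMul_algHom (K := K) (L := L) (E := E)
    obtain ⟨θ, -, hθ⟩ := hL.exists_isAffineAction hpe.symm L.val
    obtain ⟨θ', hθ'0, hθ'⟩ := hL'.exists_isAffineAction hpar' L'.val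
    obtain ⟨t, ht⟩ := hθ'.exists_cycle hp hp2
    obtain ⟨x, hx⟩ := hθ.exists_eq_stabilizer hp hp2 he L'.fixingSubgroup
      (by rw [← IntermediateField.finrank_eq_fixingSubgroup_index, hpar'])
      ⟨t, fun k hk => ht k (by
        rwa [hθ'0, ← MulAction.mem_stabilizer_iff, AlgEquiv.stabilizer_val])⟩
    obtain ⟨σ, rfl⟩ := MulAction.exists_smul_eq (E ≃ₐ[K] E) L.val x
    refine ⟨σ, ?_⟩
    -- The stabiliser of `σ • L.val` is the fixing subgroup of `σ(L)`, so the Galois correspondence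
    -- identifies the fields.
    rw [← IsGalois.fixedField_fixingSubgroup L', hx,
      ← IsGalois.fixedField_fixingSubgroup (L.map (σ : E →ₐ[K] E)),
      IsGalois.map_fixingSubgroup, ← MulAction.map_conj_stabilizer_eq,
      AlgEquiv.stabilizer_val]
    rfl
  · rintro ⟨σ, rfl⟩
    exact hL.of_algEquiv (IntermediateField.intermediateFieldMap σ L)
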